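/- For an integer $k\ge1$ and $0<q<1$ let $S_k(q)=\sum_{j\ge1}\frac1{j^k}\,\frac{q^j}{1-q^j}$, and let $q_1=e^{-\pi}$. Say that a series with terms $t_1,t_2,\ldots$ has merit $a\ge0$ if $t_{j+1}/t_j\to e^{-\pi\sqrt a}$ as $j\to\infty$. For an integer $N\ge 1$ and $z\in\mathbb C\setminus\{0\}$ let $$\mathcal H_N(z)=(-1)^{N+1}\sum_{m=0}^{N+1}z^{2m-1}\binom{2N+2}{2m}\mathcal B_{2m}\mathcal B_{2N+2-2m},$$ where $\mathcal B_j$ are the Bernoulli numbers. Let $n\ge1$ and $k=4n+1$. Then $$d_n=5^{4n+1}-2(-4)^{3n}-2^{4n}-(2+i)^{4n}-(2-i)^{4n}$$ is a nonzero integer, and there are rational numbers $D_{k,0},D_{k,4},D_{k,5},D_{k,10},D_{k,20}$, with $D_{k,4}\neq0$ and $D_{k,20}\ne0$, such that $$D_{k,20}=\frac{D_{k,5}}{2^{4n}}=\left(1-\frac{2^{4n+1}+1}{(-4)^n}\right)\frac2{d_n},\qquad \frac{D_{k,10}}{D_{k,20}}=-\left(2^{4n+1}+(-4)^n+1\right),\qquad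 \sum_{d\in\{4,5,10,20\}}D_{k,d}=-2,$$ $$\frac{(4n)!\,(2n+1)(4n+3)}{2^{4n}}\,d_n\,D_{k,0}=\frac{(4n+3)5^{4n}}{4n+1}\,\Im\left(2\mathcal H_{2n}\Big(\frac{2+2i}5\Big)+2\mathcal H_{2n}\Big(\frac{1+2i}5\Big)+\mathcal H_{2n}\Big(\frac{2i}5\Big)\right),$$ and $$\zeta(k)=D_{k,0}\,\pi^k+\sum_{d\in\{4,5,10,20\}}D_{k,d}\,S_k(q_1^d),$$ where the four series $S_k(q_1^d)$ converge. For each $d\in\{4,5,10,20\}$ the series $S_k(q_1^d)$ has merit $d^2$, so the least of these merits is $16$, and the combined series $\sum_{j\ge1}\sum_{d\in\{4,5,10,20\}}D_{k,d}\,\frac1{j^k}\,\frac{q_1^{dj}}{1-q_1^{dj}}$ has merit $16$. -/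

import Mathlib

noncomputable section

namespace ZetaFamily

/-- The `m`-th term (`m = 0, 1, 2, …`) of the Lambert series `S_k(q)`, that is
`(1 / j ^ k) * (q ^ j / (1 - q ^ j))` with `j = m + 1`. -/
def lambertTerm (k : ℕ) (q : ℝ) (m : ℕ) : ℝ :=
  1 / ((m : ℝ) + 1) ^ k * (q ^ (m + 1) / (1 - q ^ (m + 1)))

/-- The Lambert series `S_k(q) = ∑_{j ≥ 1} (1 / j ^ k) * (q ^ j / (1 - q ^ j))`. -/
def lambertS (k : ℕ) (q : ℝ) : ℝ := ∑' m : ℕ, lambertTerm k q m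

/-- The nome `q₁ = exp (-π)`. -/
def q₁ : ℝ := Real.exp (-Real.pi)

/-- A series with terms `t 0, t 1, …` has merit `a` when the ratio of successive terms tends to
`exp (-π √a)`. Since this limit is not zero, all but finitely many terms are then nonzero. -/
def HasMerit (t : ℕ → ℝ) (a : ℝ) : Prop :=
  Filter.Tendsto (fun m => t (m + 1) / t m) Filter.atTop
    (nhds (Real.exp (-Real.pi * Real.sqrt a)))

/-- `H_n(z) = (-1)^(n+1) ∑_{m=0}^{n+1} z^(2m-1) (2n+2 choose 2m) B_{2m} B_{2n+2-2m}`,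
with an integer exponent `2m - 1` and the Bernoulli numbers `B_j`. -/
def H (n : ℕ) (z : ℂ) : ℂ :=
  (-1) ^ (n + 1) * ∑ m ∈ Finset.range (n + 2),
    z ^ (2 * (m : ℤ) - 1) * ((2 * n + 2).choose (2 * m) : ℂ)
      * ((bernoulli (2 * m) : ℚ) : ℂ) * ((bernoulli (2 * n + 2 - 2 * m) : ℚ) : ℂ)

end ZetaFamily

end

/-! Write E(τ) = ζ(k) + 2 S_k(e^{2πiτ}), with k = 4n+1. Two kinds of relation tie its values
together. Ramanujan's formula (`lambertE_sub_eq`) says that E(τ) - τ^{4n} E(-1/τ) is an explicit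
multiple of π^k H(τ). It comes from the sum of π cot(πjτ)/j^k, expanded once in exponentials and
once in partial fractions; the resulting double series obeys a reciprocity whose right side is a
finite sum of products of even zeta values. Besides, E is a Hecke eigenfunction:
`sum_lambertE_hecke` gives the sum of E over the points (τ+a)/p in terms of E(τ) and E(pτ).

Apply T_5 at 2i. Inversion carries the five orbit points, up to integer translation, to 5i/2, to 2i
twice, and to the two points of the T_2-orbit of (5i+1)/2. The factors τ^{4n} at (±2+2i)/5 agree
because (±2+2i)^4 = -64, so only the sum over that T_2-orbit enters. Then T_2 at (5i+1)/2 and at 5i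
removes the auxiliary points and leaves a linear relation between E at 2i, 5i/2, 5i and 10i
(`lambertE_relation`), whose nomes are q₁^4, q₁^5, q₁^10 and q₁^20. The four coefficients add up to
-d_n, so solving for ζ(k) needs only d_n ≠ 0, which follows because 5·625^n dominates the other
terms. The points z and -z̄ occur in pairs, so the H-terms collapse to imaginary parts, which are
rational since H preserves ℚ(i). -/

/-! ### The double series: absolute convergence and reciprocity -/

theorem abs_im_div_norm_mul_le_norm_mul_sub {τ : ℂ} (hτ : τ.im ≠ 0) (a b : ℝ) :
    |τ.im| / ‖τ‖ * |b| ≤ ‖(a : ℂ) * τ - b‖ := by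
  have h0 : τ ≠ 0 := by rintro rfl; simp at hτ
  have hpos : 0 < ‖τ‖ := norm_pos_iff.mpr h0
  have h1 : ‖((a : ℂ) * τ - b) * (starRingEnd ℂ) τ‖ = ‖(a : ℂ) * τ - b‖ * ‖τ‖ := by
    rw [norm_mul, RCLike.norm_conj]
  have h2 := Complex.abs_im_le_norm (((a : ℂ) * τ - b) * (starRingEnd ℂ) τ)
  rw [h1] at h2
  have h3 : (((a : ℂ) * τ - b) * (starRingEnd ℂ) τ).im = b * τ.im := by
    simp; ring
  rw [h3, abs_mul] at h2
  rw [div_mul_eq_mul_div, div_le_iff₀ hpos]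
  linarith

/-- Both factors aτ - b and aτ + b are bounded below by a multiple of b, uniformly in a. This leaves
the decay a^{-2p} of the double series untouched, so it is dominated by a product of two convergent
series. -/
theorem sq_mul_sq_sub_sq_ne_zero {τ : ℂ} (hτ : τ.im ≠ 0) (a b : ℕ+) :
    (a : ℂ) ^ 2 * τ ^ 2 - (b : ℂ) ^ 2 ≠ 0 ∧
      1 / ‖(a : ℂ) ^ 2 * τ ^ 2 - (b : ℂ) ^ 2‖ ≤ (|τ.im| / ‖τ‖)⁻¹ ^ 2 * (1 / (b : ℝ) ^ 2) := by
  have h0 : τ ≠ 0 := by rintro rfl; simp at hτ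
  have hpos : 0 < ‖τ‖ := norm_pos_iff.mpr h0
  have hc : 0 < |τ.im| / ‖τ‖ := div_pos (abs_pos.mpr hτ) hpos
  have hb : (0 : ℝ) < b := by exact_mod_cast b.pos
  have h1 := abs_im_div_norm_mul_le_norm_mul_sub hτ a b
  have h2 := abs_im_div_norm_mul_le_norm_mul_sub hτ a (-b)
  rw [abs_neg] at h2
  rw [abs_of_pos hb] at h1 h2
  have h3 : ‖(a : ℂ) ^ 2 * τ ^ 2 - (b : ℂ) ^ 2‖
      = ‖((a : ℝ) : ℂ) * τ - ((b : ℝ) : ℂ)‖ * ‖((a : ℝ) : ℂ) * τ - ((-(b : ℝ) : ℝ) : ℂ)‖ := by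
    rw [← norm_mul]; congr 1; push_cast; ring
  have h4 : (|τ.im| / ‖τ‖ * b) ^ 2 ≤ ‖(a : ℂ) ^ 2 * τ ^ 2 - (b : ℂ) ^ 2‖ := by
    rw [h3, sq]
    exact mul_le_mul h1 h2 (by positivity) (by positivity)
  have h5 : 0 < (|τ.im| / ‖τ‖ * b) ^ 2 := by positivity
  refine ⟨norm_pos_iff.mp (h5.trans_le h4), ?_⟩
  calc _ ≤ 1 / (|τ.im| / ‖τ‖ * b) ^ 2 := one_div_le_one_div_of_le h5 h4
    _ = _ := by rw [mul_pow, inv_pow]; field_simp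

theorem summable_pnat_one_div_pow {k : ℕ} (hk : 1 < k) :
    Summable fun j : ℕ+ => 1 / (j : ℝ) ^ k :=
  (Real.summable_one_div_nat_pow.mpr hk).comp_injective PNat.coe_injective

theorem summable_one_div_natCast_pow_complex {k : ℕ} (hk : 1 < k) :
    Summable fun j : ℕ => 1 / (j : ℂ) ^ k :=
  Summable.of_norm (by simpa using Real.summable_one_div_nat_pow.mpr hk)

theorem hasSum_pnat_riemannZeta {k : ℕ} (hk : 1 < k) :
    HasSum (fun j : ℕ+ => 1 / (j : ℂ) ^ k) (riemannZeta k) := by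
  have h := (summable_one_div_natCast_pow_complex hk).hasSum
  rw [← zeta_nat_eq_tsum_of_gt_one hk] at h
  refine (Function.Injective.hasSum_iff PNat.coe_injective ?_).mpr h
  intro x hx
  have : x = 0 := by
    by_contra hx0
    exact hx ⟨⟨x, Nat.pos_of_ne_zero hx0⟩, rfl⟩
  subst this
  simp [show k ≠ 0 by omega]

/-- The double series obtained from `∑ cot (π j τ) / j ^ (2p+1)` by expanding the cotangents in
partial fractions. -/
noncomputable def cotDoubleTerm (p : ℕ) (τ : ℂ) (x : ℕ+ × ℕ+) : ℂ :=
  1 / ((x.1 : ℂ) ^ (2 * p) * ((x.1 : ℂ) ^ 2 * τ ^ 2 - (x.2 : ℂ) ^ 2))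

theorem summable_cotDoubleTerm {p : ℕ} (hp : 1 ≤ p) {τ : ℂ} (hτ : τ.im ≠ 0) :
    Summable (cotDoubleTerm p τ) := by
  have h := ((summable_pnat_one_div_pow (k := 2 * p) (by omega)).mul_of_nonneg
    (summable_pnat_one_div_pow (k := 2) (by omega))
    (fun _ => by positivity) (fun _ => by positivity)).mul_left ((|τ.im| / ‖τ‖)⁻¹ ^ 2)
  refine Summable.of_norm_bounded h ?_
  rintro ⟨a, b⟩
  have := (sq_mul_sq_sub_sq_ne_zero hτ a b).2
  simp only [cotDoubleTerm, norm_div, norm_one, norm_mul, norm_pow]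
  rw [one_div_mul_eq_div, Complex.norm_natCast]
  calc _ = 1 / (a : ℝ) ^ (2 * p) * (1 / ‖(a : ℂ) ^ 2 * τ ^ 2 - (b : ℂ) ^ 2‖) := by
        rw [one_div_mul_one_div]
    _ ≤ 1 / (a : ℝ) ^ (2 * p) * ((|τ.im| / ‖τ‖)⁻¹ ^ 2 * (1 / (b : ℝ) ^ 2)) := by gcongr
    _ = _ := by simp only [div_eq_mul_inv]; ring

/-- Reciprocity for the double series: partial fractions reduce it to products of zeta values. -/
theorem tsum_cotDoubleTerm_add {p : ℕ} (hp : 1 ≤ p) {τ : ℂ} (hτ : τ.im ≠ 0) :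
    ∑' x, cotDoubleTerm p τ x + τ ^ (2 * p - 2) * ∑' x, cotDoubleTerm p (-1 / τ) x
      = -∑ s ∈ Finset.range p, τ ^ (2 * s) *
          (riemannZeta (2 * p - 2 * s : ℕ) * riemannZeta (2 * s + 2 : ℕ)) := by
  have h0 : τ ≠ 0 := by rintro rfl; simp at hτ
  have hτ' : (-1 / τ).im ≠ 0 := by
    rw [Complex.div_im]
    simp only [Complex.neg_im, Complex.one_im, Complex.neg_re, Complex.one_re]
    have : Complex.normSq τ ≠ 0 := by simpa using h0
    field_simp
    simpa using ⟨hτ, h0⟩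
  have h1 := (summable_cotDoubleTerm hp hτ).hasSum
  have h2 := ((Equiv.prodComm ℕ+ ℕ+).hasSum_iff.mpr
    (summable_cotDoubleTerm hp hτ').hasSum).mul_left (τ ^ (2 * p - 2))
  have h3 : ∀ s ∈ Finset.range p, HasSum (fun x : ℕ+ × ℕ+ => τ ^ (2 * s) *
      (1 / (x.1 : ℂ) ^ (2 * p - 2 * s) * (1 / (x.2 : ℂ) ^ (2 * s + 2))))
      (τ ^ (2 * s) * (riemannZeta (2 * p - 2 * s : ℕ) * riemannZeta (2 * s + 2 : ℕ))) := by
    intro s hs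
    have hs' := Finset.mem_range.mp hs
    have a1 := hasSum_pnat_riemannZeta (k := 2 * p - 2 * s) (by omega)
    have a2 := hasSum_pnat_riemannZeta (k := 2 * s + 2) (by omega)
    refine (a1.mul a2 ?_).mul_left _
    exact summable_mul_of_summable_norm (f := fun j : ℕ+ => 1 / (j : ℂ) ^ (2 * p - 2 * s))
      (g := fun j : ℕ+ => 1 / (j : ℂ) ^ (2 * s + 2))
      (by simpa using summable_pnat_one_div_pow (k := 2 * p - 2 * s) (by omega))
      (by simpa using summable_pnat_one_div_pow (k := 2 * s + 2) (by omega))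
  have h4 := (hasSum_sum h3).neg
  refine (h1.add h2).unique (h4.congr_fun ?_)
  rintro ⟨a, b⟩
  have ha : (a : ℂ) ≠ 0 := by exact_mod_cast a.ne_zero
  have hb : (b : ℂ) ≠ 0 := by exact_mod_cast b.ne_zero
  have hD := (sq_mul_sq_sub_sq_ne_zero hτ a b).1
  have hD' := (sq_mul_sq_sub_sq_ne_zero hτ' b a).1
  simp only [cotDoubleTerm, Function.comp, Equiv.prodComm_apply, Prod.swap]
  obtain ⟨r, rfl⟩ : ∃ r, p = r + 1 := ⟨p - 1, by omega⟩
  -- With X = a²τ² and Y = b², the two terms combine to -(X^p - Y^p) / ((X - Y)(ab)^{2p}), a finite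
  -- geometric sum. Absolute convergence permitted the swap of indices in the second series.
  have key := (Commute.all ((a : ℂ) ^ 2 * τ ^ 2) ((b : ℂ) ^ 2)).geom_sum₂_mul (r + 1)
  have e1 : ∑ s ∈ Finset.range (r + 1), τ ^ (2 * s) *
      (1 / (a : ℂ) ^ (2 * (r + 1) - 2 * s) * (1 / (b : ℂ) ^ (2 * s + 2)))
      = (∑ s ∈ Finset.range (r + 1), ((a : ℂ) ^ 2 * τ ^ 2) ^ s * ((b : ℂ) ^ 2) ^ (r + 1 - 1 - s))
        / ((a : ℂ) ^ (2 * (r + 1)) * (b : ℂ) ^ (2 * (r + 1))) := by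
    rw [Finset.sum_div]
    refine Finset.sum_congr rfl fun s hs => ?_
    have hs' : s ≤ r := by have := Finset.mem_range.mp hs; omega
    obtain ⟨t, rfl⟩ : ∃ t, r = s + t := ⟨r - s, by omega⟩
    rw [show 2 * (s + t + 1) - 2 * s = 2 * t + 2 by omega, show s + t + 1 - 1 - s = t by omega]
    field_simp
    ring
  have e2 : (b : ℂ) ^ 2 * (-1 / τ) ^ 2 - (a : ℂ) ^ 2
      = -((a : ℂ) ^ 2 * τ ^ 2 - (b : ℂ) ^ 2) / τ ^ 2 := by field_simp; ring
  rw [e1, eq_div_of_mul_eq hD key, e2, show 2 * (r + 1) - 2 = 2 * r by omega]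
  field_simp
  ring

/-! ### Cotangent sums and Lambert series -/

theorem pi_mul_cot_mul_eq {τ : ℂ} (hτ : 0 < τ.im) (j : ℕ+) :
    Real.pi * Complex.cot (Real.pi * ((j : ℂ) * τ)) = -(Real.pi * Complex.I) *
      (1 + 2 * (Complex.exp (2 * Real.pi * Complex.I * τ) ^ (j : ℕ) /
        (1 - Complex.exp (2 * Real.pi * Complex.I * τ) ^ (j : ℕ)))) := by
  have hj : (0 : ℝ) < j := by exact_mod_cast j.pos
  have e : Complex.exp (2 * Real.pi * Complex.I * ((j : ℂ) * τ))
      = Complex.exp (2 * Real.pi * Complex.I * τ) ^ (j : ℕ) := by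
    rw [← Complex.exp_nat_mul]; congr 1; ring
  have hlt : ‖Complex.exp (2 * Real.pi * Complex.I * τ) ^ (j : ℕ)‖ < 1 := by
    rw [norm_pow, Complex.norm_exp]
    refine pow_lt_one₀ (by positivity) ?_ j.ne_zero
    simp
    positivity
  have hne : 1 - Complex.exp (2 * Real.pi * Complex.I * τ) ^ (j : ℕ) ≠ 0 := by
    intro h
    rw [← sub_eq_zero.mp h] at hlt
    simp at hlt
  rw [Complex.cot_pi_eq_exp_ratio, e]
  generalize Complex.exp (2 * Real.pi * Complex.I * τ) ^ (j : ℕ) = Q at hne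
  field_simp
  rw [Complex.I_sq]
  ring

/-- The Lambert series `S_k(q)` at a complex argument. -/
noncomputable def lambertC (k : ℕ) (q : ℂ) : ℂ :=
  ∑' j : ℕ+, 1 / (j : ℂ) ^ k * (q ^ (j : ℕ) / (1 - q ^ (j : ℕ)))

theorem one_sub_pow_ne_zero {q : ℂ} (hq : ‖q‖ < 1) (j : ℕ+) : 1 - q ^ (j : ℕ) ≠ 0 := by
  intro h
  have := pow_lt_one₀ (norm_nonneg q) hq j.ne_zero
  rw [← norm_pow, ← sub_eq_zero.mp h] at this
  simp at this

theorem summable_lambertC (k : ℕ) {q : ℂ} (hq : ‖q‖ < 1) :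
    Summable fun j : ℕ+ => 1 / (j : ℂ) ^ k * (q ^ (j : ℕ) / (1 - q ^ (j : ℕ))) := by
  have h1 : Summable fun j : ℕ+ => ‖q‖ ^ (j : ℕ) * (1 / (1 - ‖q‖)) :=
    ((summable_geometric_of_lt_one (norm_nonneg q) hq).comp_injective
      PNat.coe_injective).mul_right _
  refine Summable.of_norm_bounded h1 fun j => ?_
  rw [norm_mul, norm_div, norm_div, norm_pow, norm_pow, norm_one, Complex.norm_natCast]
  have hj : (1 : ℝ) ≤ j := Nat.one_le_cast.mpr j.pos
  have h2 : 1 / (j : ℝ) ^ k ≤ 1 := by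
    rw [div_le_one (by positivity)]; exact one_le_pow₀ hj
  have h3 : 1 - ‖q‖ ≤ ‖1 - q ^ (j : ℕ)‖ := by
    have := norm_sub_norm_le (1 : ℂ) (q ^ (j : ℕ))
    rw [norm_one, norm_pow] at this
    have h5 := pow_le_of_le_one (norm_nonneg q) hq.le j.ne_zero
    linarith
  have h4 : 0 < 1 - ‖q‖ := by linarith
  calc _ ≤ 1 * (‖q‖ ^ (j : ℕ) / ‖1 - q ^ (j : ℕ)‖) := by gcongr
    _ ≤ _ := by rw [one_mul, mul_one_div]; gcongr

theorem norm_exp_two_pi_I_mul_lt_one {τ : ℂ} (hτ : 0 < τ.im) :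
    ‖Complex.exp (2 * Real.pi * Complex.I * τ)‖ < 1 := by
  rw [Complex.norm_exp]
  simp
  positivity

/-- Both sides are the sum of π cot(πjτ)/j^{2p+1}: the left by the exponential form of the
cotangent, the right by its partial fractions, where the pole 1/(jτ) produces the term ζ(2p+2)/τ. -/
theorem lambertC_exp_eq {p : ℕ} (hp : 1 ≤ p) {τ : ℂ} (hτ : 0 < τ.im) :
    -(Real.pi * Complex.I) * (riemannZeta (2 * p + 1 : ℕ)
        + 2 * lambertC (2 * p + 1) (Complex.exp (2 * Real.pi * Complex.I * τ)))
      = riemannZeta (2 * p + 2 : ℕ) / τ + 2 * τ * ∑' x, cotDoubleTerm p τ x := by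
  have h0 : τ ≠ 0 := by rintro rfl; simp at hτ
  have a1 := ((hasSum_pnat_riemannZeta (k := 2 * p + 1) (by omega)).add
    ((summable_lambertC (2 * p + 1) (norm_exp_two_pi_I_mul_lt_one hτ)).hasSum.mul_left
      2)).mul_left (-(Real.pi * Complex.I))
  have hs := summable_cotDoubleTerm hp hτ.ne'
  have a2 := ((hasSum_pnat_riemannZeta (k := 2 * p + 2) (by omega)).div_const τ).add
    ((hs.hasSum.prod_fiberwise fun a => (hs.prod_factor a).hasSum).mul_left (2 * τ))
  refine a1.unique (a2.congr_fun ?_)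
  intro j
  have hj : (j : ℂ) ≠ 0 := by exact_mod_cast j.ne_zero
  have hjτ : (j : ℂ) * τ ∈ Complex.integerComplement := by
    refine UpperHalfPlane.coe_mem_integerComplement ⟨(j : ℂ) * τ, ?_⟩
    have hj : (0 : ℝ) < j := by exact_mod_cast j.pos
    simpa using mul_pos hj hτ
  have e1 := pi_mul_cot_mul_eq hτ j
  rw [cot_series_rep hjτ] at e1
  have e2 : ∑' m : ℕ+, (1 / ((j : ℂ) * τ - m) + 1 / ((j : ℂ) * τ + m))
      = 2 * τ * (j : ℂ) ^ (2 * p + 1) * ∑' m : ℕ+, cotDoubleTerm p τ (j, m) := by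
    rw [← tsum_mul_left]
    refine tsum_congr fun m => ?_
    have hD := (sq_mul_sq_sub_sq_ne_zero hτ.ne' j m).1
    have hf : (j : ℂ) ^ 2 * τ ^ 2 - (m : ℂ) ^ 2
        = ((j : ℂ) * τ - m) * ((j : ℂ) * τ + m) := by ring
    rw [hf] at hD
    have hD1 := left_ne_zero_of_mul hD
    have hD2 := right_ne_zero_of_mul hD
    simp only [cotDoubleTerm, hf]
    field_simp
    ring
  rw [e2] at e1
  have e3 : -(Real.pi * Complex.I) * (1 / (j : ℂ) ^ (2 * p + 1) +
      2 * (1 / (j : ℂ) ^ (2 * p + 1) * (Complex.exp (2 * Real.pi * Complex.I * τ) ^ (j : ℕ) /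
        (1 - Complex.exp (2 * Real.pi * Complex.I * τ) ^ (j : ℕ)))))
      = 1 / (j : ℂ) ^ (2 * p + 1) * (-(Real.pi * Complex.I) *
      (1 + 2 * (Complex.exp (2 * Real.pi * Complex.I * τ) ^ (j : ℕ) /
        (1 - Complex.exp (2 * Real.pi * Complex.I * τ) ^ (j : ℕ))))) := by ring
  rw [e3, ← e1]
  field_simp
  ring

/-! ### Even zeta values and Ramanujan's formula -/

/-- Euler's formula persists at k = 0, where ζ(0) = -1/2. This lets the end terms of `H` be treated
like the others. -/
theorem riemannZeta_two_mul_nat_all (k : ℕ) :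
    riemannZeta (2 * k : ℕ) = (-1) ^ (k + 1) * (2 : ℂ) ^ (2 * k)
      * (Real.pi : ℂ) ^ (2 * k) * ((bernoulli (2 * k) : ℚ) : ℂ) / (2 * (Nat.factorial (2 * k))) := by
  rcases Nat.eq_zero_or_pos k with rfl | hk
  · simp [riemannZeta_zero]
  · have h := riemannZeta_two_mul_nat hk.ne'
    push_cast
    rw [h]
    obtain ⟨r, rfl⟩ : ∃ r, k = r + 1 := ⟨k - 1, by omega⟩
    rw [show 2 * (r + 1) - 1 = 2 * r + 1 by omega, show 2 * (r + 1) = 2 * r + 1 + 1 by omega]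
    have : (Nat.factorial (2 * r + 1 + 1) : ℂ) ≠ 0 := by exact_mod_cast Nat.factorial_ne_zero _
    field_simp
    ring

theorem riemannZeta_mul_riemannZeta_eq {p m : ℕ} (hm : m ≤ p + 1) :
    riemannZeta (2 * m : ℕ) * riemannZeta (2 * p + 2 - 2 * m : ℕ)
      = (-1) ^ (p + 1) * (2 : ℂ) ^ (2 * p) * (Real.pi : ℂ) ^ (2 * p + 2)
        / (Nat.factorial (2 * p + 2)) * (((2 * p + 2).choose (2 * m) : ℂ)
      * ((bernoulli (2 * m) : ℚ) : ℂ) * ((bernoulli (2 * p + 2 - 2 * m) : ℚ) : ℂ)) := by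
  obtain ⟨r, hr⟩ : ∃ r, p + 1 = m + r := ⟨p + 1 - m, by omega⟩
  have e : 2 * p + 2 - 2 * m = 2 * r := by omega
  have e' : 2 * p + 2 = 2 * m + 2 * r := by omega
  rw [e, riemannZeta_two_mul_nat_all, riemannZeta_two_mul_nat_all, hr, e',
    Nat.cast_add_choose]
  have h1 : (Nat.factorial (2 * m) : ℂ) ≠ 0 := by exact_mod_cast Nat.factorial_ne_zero _
  have h2 : (Nat.factorial (2 * r) : ℂ) ≠ 0 := by exact_mod_cast Nat.factorial_ne_zero _
  have h3 : (Nat.factorial (2 * m + 2 * r) : ℂ) ≠ 0 := by exact_mod_cast Nat.factorial_ne_zero _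
  have h4 : (2 : ℂ) ^ (2 * m) * 2 ^ (2 * r) = 4 * 2 ^ (2 * p) := by
    rw [← pow_add, ← e']; ring
  have h5 : ((-1 : ℂ)) ^ (m + 1) * (-1) ^ (r + 1) = (-1) ^ (m + r) := by ring
  rw [← h5, div_mul_div_comm, pow_add (Real.pi : ℂ)]
  generalize (-1 : ℂ) ^ (m + 1) = s
  generalize (-1 : ℂ) ^ (r + 1) = t
  calc _ = ((2 : ℂ) ^ (2 * m) * 2 ^ (2 * r)) * (s * t * (Real.pi : ℂ) ^ (2 * m) *
        (Real.pi : ℂ) ^ (2 * r) * ((bernoulli (2 * m) : ℚ) : ℂ) * ((bernoulli (2 * r) : ℚ) : ℂ)) /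
          (4 * (Nat.factorial (2 * m)) * (Nat.factorial (2 * r))) := by congr 1 <;> ring
    _ = _ := by
      rw [h4]
      generalize (2 : ℂ) ^ (2 * p) = B
      generalize (Real.pi : ℂ) ^ (2 * m) = P
      generalize (Real.pi : ℂ) ^ (2 * r) = R
      field_simp

open ZetaFamily in
theorem sum_zpow_mul_riemannZeta (p : ℕ) (τ : ℂ) :
    ∑ m ∈ Finset.range (p + 2), τ ^ (2 * (m : ℤ) - 1) *
        (riemannZeta (2 * m : ℕ) * riemannZeta (2 * p + 2 - 2 * m : ℕ))
      = (2 : ℂ) ^ (2 * p) * (Real.pi : ℂ) ^ (2 * p + 2) / (Nat.factorial (2 * p + 2)) * H p τ := by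
  rw [H, Finset.mul_sum, Finset.mul_sum]
  refine Finset.sum_congr rfl fun m hm => ?_
  rw [riemannZeta_mul_riemannZeta_eq (by have := Finset.mem_range.mp hm; omega)]
  ring

/-- `ζ(k) + 2 S_k(e^{2π i τ})`, the completed Lambert series of the transformation formula. -/
noncomputable def lambertE (k : ℕ) (τ : ℂ) : ℂ :=
  riemannZeta k + 2 * lambertC k (Complex.exp (2 * Real.pi * Complex.I * τ))

open ZetaFamily in
/-- Ramanujan's formula: the transformation of the completed Lambert series under `τ ↦ -1/τ`. -/
theorem lambertE_sub_eq {p : ℕ} (hp : 1 ≤ p) {τ : ℂ} (hτ : 0 < τ.im) :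
    lambertE (2 * p + 1) τ - τ ^ (2 * p) * lambertE (2 * p + 1) (-1 / τ)
      = -Complex.I * (2 ^ (2 * p + 1) * (Real.pi : ℂ) ^ (2 * p + 1)
          / (Nat.factorial (2 * p + 2))) * H p τ := by
  have h0 : τ ≠ 0 := by rintro rfl; simp at hτ
  have hpi : (Real.pi : ℂ) ≠ 0 := by exact_mod_cast Real.pi_ne_zero
  have hτ' : 0 < (-1 / τ).im := by
    have h : 0 < Complex.normSq τ := Complex.normSq_pos.mpr h0
    rw [Complex.div_im]
    simp only [Complex.neg_im, Complex.one_im, Complex.neg_re, Complex.one_re]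
    have : -0 * τ.re / Complex.normSq τ - -1 * τ.im / Complex.normSq τ
      = τ.im / Complex.normSq τ := by ring
    rw [this]
    positivity
  have h1 : -(Real.pi * Complex.I) * lambertE (2 * p + 1) τ = _ := lambertC_exp_eq hp hτ
  have h2 : -(Real.pi * Complex.I) * lambertE (2 * p + 1) (-1 / τ) = _ := lambertC_exp_eq hp hτ'
  have h3 := tsum_cotDoubleTerm_add hp hτ.ne'
  have h4 := sum_zpow_mul_riemannZeta p τ
  -- The terms m = 0 and m = p+1 carry ζ(0) and match the two contributions of ζ(2p+2)/τ; the inner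
  -- terms are the reciprocity sum.
  rw [Finset.sum_range_succ, Finset.sum_range_succ'] at h4
  have e1 : ∑ m ∈ Finset.range p, τ ^ (2 * ((m + 1 : ℕ) : ℤ) - 1) *
        (riemannZeta (2 * (m + 1) : ℕ) * riemannZeta (2 * p + 2 - 2 * (m + 1) : ℕ))
      = τ * ∑ s ∈ Finset.range p, τ ^ (2 * s) *
          (riemannZeta (2 * p - 2 * s : ℕ) * riemannZeta (2 * s + 2 : ℕ)) := by
    rw [Finset.mul_sum]
    refine Finset.sum_congr rfl fun s _ => ?_
    rw [show 2 * p + 2 - 2 * (s + 1) = 2 * p - 2 * s by omega, show 2 * (s + 1) = 2 * s + 2 by ring,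
      show 2 * ((s + 1 : ℕ) : ℤ) - 1 = ((2 * s + 1 : ℕ) : ℤ) by push_cast; ring, zpow_natCast]
    ring
  have e2 : τ ^ (2 * ((p + 1 : ℕ) : ℤ) - 1) = τ ^ (2 * p + 1) := by
    rw [show 2 * ((p + 1 : ℕ) : ℤ) - 1 = ((2 * p + 1 : ℕ) : ℤ) by push_cast; ring, zpow_natCast]
  have e3 : τ ^ (2 * ((0 : ℕ) : ℤ) - 1) = 1 / τ := by simp
  rw [e1, e2, e3, show 2 * p + 2 - 2 * (p + 1) = 0 by omega, show 2 * p + 2 - 2 * 0 = 2 * p + 2 by omega,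
    show 2 * (p + 1) = 2 * p + 2 by ring, mul_zero, Nat.cast_zero, riemannZeta_zero] at h4
  have e4 : (Real.pi : ℂ) * (lambertE (2 * p + 1) τ - τ ^ (2 * p) * lambertE (2 * p + 1) (-1 / τ))
      = Real.pi * (-Complex.I * (2 ^ (2 * p + 1) * (Real.pi : ℂ) ^ (2 * p + 1)
          / (Nat.factorial (2 * p + 2))) * H p τ) := by
    have e5 : -(Real.pi * Complex.I) * (lambertE (2 * p + 1) τ - τ ^ (2 * p) * lambertE (2 * p + 1) (-1 / τ))
      = -2 * ((2 : ℂ) ^ (2 * p) * (Real.pi : ℂ) ^ (2 * p + 2) / (Nat.factorial (2 * p + 2)) * H p τ) := by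
      rw [← h4, mul_sub, h1, mul_left_comm, h2, ← neg_eq_iff_eq_neg.mpr h3]
      obtain ⟨r, rfl⟩ : ∃ r, p = r + 1 := ⟨p - 1, by omega⟩
      rw [show 2 * (r + 1) - 2 = 2 * r by omega]
      field_simp
      ring
    have := congrArg (fun z => Complex.I * z) e5
    calc _ = Complex.I * (-(Real.pi * Complex.I) * (lambertE (2 * p + 1) τ -
          τ ^ (2 * p) * lambertE (2 * p + 1) (-1 / τ))) := by
            linear_combination (Real.pi * (lambertE (2 * p + 1) τ -
          τ ^ (2 * p) * lambertE (2 * p + 1) (-1 / τ))) * Complex.I_sq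
      _ = _ := by rw [this]; ring
  exact mul_left_cancel₀ hpi e4

/-! ### Hecke operators on the Lambert series -/

/-- Since (ω^a x)^p = x^p, every summand has a truncated geometric sum over the common denominator 1
- x^p; orthogonality of roots of unity keeps only its constant term. -/
theorem sum_div_one_sub_mul_pow {p : ℕ} {ω x : ℂ} (hp : 1 < p) (hω : IsPrimitiveRoot ω p)
    (hx : 1 - x ^ p ≠ 0) :
    ∑ a ∈ Finset.range p, (ω ^ a * x) / (1 - ω ^ a * x) = p * (x ^ p / (1 - x ^ p)) := by
  have h1 : ∀ a ∈ Finset.range p, (ω ^ a * x) / (1 - ω ^ a * x)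
      = (∑ r ∈ Finset.range p, (ω ^ r) ^ a * x ^ r) / (1 - x ^ p) - 1 := by
    intro a _
    have hpow : (ω ^ a * x) ^ p = x ^ p := by
      rw [mul_pow, ← pow_mul, mul_comm a, pow_mul, hω.pow_eq_one, one_pow, one_mul]
    have h2 := mul_neg_geom_sum (ω ^ a * x) p
    rw [hpow] at h2
    have h3 : 1 - ω ^ a * x ≠ 0 := fun h => hx (by rw [← h2, h, zero_mul])
    have h4 : ∑ r ∈ Finset.range p, (ω ^ r) ^ a * x ^ r = ∑ r ∈ Finset.range p, (ω ^ a * x) ^ r :=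
      Finset.sum_congr rfl fun r _ => by rw [mul_pow, ← pow_mul, ← pow_mul, mul_comm a]
    rw [h4, ← h2]
    rw [← h2] at hx
    have h5 := right_ne_zero_of_mul hx
    field_simp
    ring
  rw [Finset.sum_congr rfl h1, Finset.sum_sub_distrib, ← Finset.sum_div, Finset.sum_comm]
  have h2 : ∀ r ∈ Finset.range p, ∑ a ∈ Finset.range p, (ω ^ r) ^ a * x ^ r
      = if r = 0 then (p : ℂ) else 0 := by
    intro r hr
    rw [← Finset.sum_mul]
    split_ifs with h
    · subst h; simp
    · have hne : ω ^ r ≠ 1 := hω.pow_ne_one_of_pos_of_lt h (Finset.mem_range.mp hr)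
      have h3 := mul_neg_geom_sum (ω ^ r) p
      rw [← pow_mul, mul_comm r, pow_mul, hω.pow_eq_one, one_pow, sub_self] at h3
      rw [(mul_eq_zero.mp h3).resolve_left (sub_ne_zero.mpr hne.symm), zero_mul]
  rw [Finset.sum_congr rfl h2, Finset.sum_ite_eq', if_pos (Finset.mem_range.mpr (by omega))]
  simp only [Finset.sum_const, Finset.card_range, nsmul_eq_mul, mul_one]
  field_simp
  ring

/-- The action of the Hecke operator `T_p` on the Lambert series. -/
theorem sum_lambertC_hecke {p k : ℕ} (hp : p.Prime) {ω x : ℂ}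
    (hω : IsPrimitiveRoot ω p) (hx : ‖x‖ < 1) :
    ∑ a ∈ Finset.range p, lambertC k (ω ^ a * x)
      = (p + p / (p : ℂ) ^ k) * lambertC k (x ^ p) - p / (p : ℂ) ^ k * lambertC k ((x ^ p) ^ p) := by
  have hpow : ∀ {y : ℂ}, ‖y‖ < 1 → ‖y ^ p‖ < 1 := fun {y} hy => by
    rw [norm_pow]; exact pow_lt_one₀ (norm_nonneg y) hy hp.ne_zero
  have hω1 : ‖ω‖ = 1 := Complex.norm_eq_one_of_pow_eq_one hω.pow_eq_one hp.ne_zero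
  have hωx : ∀ a, ‖ω ^ a * x‖ < 1 := fun a => by
    rw [norm_mul, norm_pow, hω1, one_pow, one_mul]; exact hx
  let P : ℕ+ := ⟨p, hp.pos⟩
  let L : ℂ → ℂ := fun y => y / (1 - y)
  have a1 := hasSum_sum fun a (_ : a ∈ Finset.range p) => (summable_lambertC k (hωx a)).hasSum
  have b1 := (summable_lambertC k (hpow hx)).hasSum.mul_left (p : ℂ)
  have hinj : Function.Injective fun i : ℕ+ => P * i := mul_right_injective P
  -- The j-th inner sum is p L(x^{pj}) if p does not divide j, since ω^j is still primitive, and p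
  -- L(x^j) if it does. This series is the correction at multiples of p, reindexed by j = p i.
  have b3 : HasSum (fun j : ℕ+ => if p ∣ (j : ℕ) then
      1 / (j : ℂ) ^ k * (p * (L (x ^ (j : ℕ)) - L ((x ^ p) ^ (j : ℕ)))) else 0)
      (p / (p : ℂ) ^ k * (lambertC k (x ^ p) - lambertC k ((x ^ p) ^ p))) := by
    refine (hinj.hasSum_iff ?_).mp ?_
    · intro j hj
      refine if_neg fun h => hj ?_
      obtain ⟨i, hi⟩ := h
      have hi0 : 0 < i := Nat.pos_of_ne_zero (by rintro rfl; simp at hi)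
      exact ⟨⟨i, hi0⟩, PNat.eq hi.symm⟩
    · refine (((summable_lambertC k (hpow hx)).hasSum.sub
        (summable_lambertC k (hpow (hpow hx))).hasSum).mul_left (p / (p : ℂ) ^ k)).congr_fun ?_
      intro i
      have : ((P * i : ℕ+) : ℕ) = p * i := rfl
      have hp0 : (p : ℂ) ≠ 0 := by exact_mod_cast hp.ne_zero
      simp only [Function.comp, this, L]
      rw [if_pos (dvd_mul_right _ _), pow_mul, pow_mul]
      push_cast
      rw [mul_pow]
      field_simp
  have c := a1.unique ((b1.add b3).congr_fun ?_)
  · change ∑ a ∈ Finset.range p, lambertC k (ω ^ a * x) = _ at c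
    rw [c]
    change p * lambertC k (x ^ p) + _ = _
    ring
  · intro j
    simp only [mul_pow]
    rw [← Finset.mul_sum]
    split_ifs with h
    · have : ∀ a ∈ Finset.range p, (ω ^ a) ^ (j : ℕ) * x ^ (j : ℕ)
          / (1 - (ω ^ a) ^ (j : ℕ) * x ^ (j : ℕ)) = L (x ^ (j : ℕ)) := by
        intro a _
        obtain ⟨i, hi⟩ := h
        have : (ω ^ a) ^ (j : ℕ) = 1 := by
          rw [hi, ← pow_mul, mul_left_comm, pow_mul, hω.pow_eq_one, one_pow]
        rw [this, one_mul]
      rw [Finset.sum_congr rfl this, Finset.sum_const, Finset.card_range, nsmul_eq_mul]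
      simp only [L]
      ring
    · have hωj : IsPrimitiveRoot (ω ^ (j : ℕ)) p :=
        hω.pow_of_coprime _ ((Nat.Prime.coprime_iff_not_dvd hp).mpr h).symm
      have hx' : 1 - (x ^ (j : ℕ)) ^ p ≠ 0 := by
        rw [← pow_mul, mul_comm, pow_mul]; exact one_sub_pow_ne_zero (hpow hx) j
      have := sum_div_one_sub_mul_pow hp.one_lt hωj hx'
      simp only [← pow_mul] at this ⊢
      simp only [mul_comm _ (j : ℕ)] at this ⊢
      rw [this]
      ring

theorem lambertE_congr {k : ℕ} {τ τ' : ℂ} (m : ℤ) (h : τ = τ' + m) :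
    lambertE k τ = lambertE k τ' := by
  have : Complex.exp (2 * Real.pi * Complex.I * τ) = Complex.exp (2 * Real.pi * Complex.I * τ') := by
    rw [Complex.exp_eq_exp_iff_exists_int]
    exact ⟨m, by rw [h]; ring⟩
  rw [lambertE, lambertE, this]

theorem sum_lambertE_hecke {p k : ℕ} (hp : p.Prime) {τ : ℂ} (hτ : 0 < τ.im) :
    ∑ a ∈ Finset.range p, lambertE k ((τ + a) / p)
      = (p + p / (p : ℂ) ^ k) * lambertE k τ - p / (p : ℂ) ^ k * lambertE k (p * τ) := by
  have hp0 : (p : ℂ) ≠ 0 := by exact_mod_cast hp.ne_zero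
  have hpr : (0 : ℝ) < p := by exact_mod_cast hp.pos
  have hτ' : 0 < (τ / p).im := by
    rw [Complex.div_natCast_im]; positivity
  have h := sum_lambertC_hecke (k := k) hp (Complex.isPrimitiveRoot_exp p hp.ne_zero)
    (norm_exp_two_pi_I_mul_lt_one hτ')
  have e1 : Complex.exp (2 * Real.pi * Complex.I * (τ / p)) ^ p
      = Complex.exp (2 * Real.pi * Complex.I * τ) := by
    rw [← Complex.exp_nat_mul]; congr 1; field_simp
  have e2 : Complex.exp (2 * Real.pi * Complex.I * τ) ^ p
      = Complex.exp (2 * Real.pi * Complex.I * (p * τ)) := by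
    rw [← Complex.exp_nat_mul]; congr 1; ring
  have e3 : ∀ a ∈ Finset.range p, lambertE k ((τ + a) / p) = riemannZeta k + 2 *
      lambertC k (Complex.exp (2 * Real.pi * Complex.I / p) ^ a *
        Complex.exp (2 * Real.pi * Complex.I * (τ / p))) := by
    intro a _
    rw [lambertE, ← Complex.exp_nat_mul, ← Complex.exp_add]
    congr 4
    field_simp
    ring
  rw [Finset.sum_congr rfl e3, Finset.sum_add_distrib, ← Finset.mul_sum, h, e1, e2,
    Finset.sum_const, Finset.card_range, nsmul_eq_mul, lambertE, lambertE]
  ring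

/-! ### Symmetry and rationality of `H` -/

-- Only odd powers of z occur, with rational coefficients.
open ZetaFamily in
theorem H_neg_conj (N : ℕ) (z : ℂ) :
    H N (-(starRingEnd ℂ) z) = -(starRingEnd ℂ) (H N z) := by
  simp only [H, map_mul, map_sum, map_pow, map_neg, map_one, map_natCast, map_ratCast, map_zpow₀]
  rw [← mul_neg, ← Finset.sum_neg_distrib]
  congr 1
  refine Finset.sum_congr rfl fun m _ => ?_
  rw [Odd.neg_zpow ⟨(m : ℤ) - 1, by ring⟩]
  ring

open ZetaFamily in
theorem H_add_H_neg_conj (N : ℕ) (z : ℂ) :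
    H N z + H N (-(starRingEnd ℂ) z) = 2 * Complex.I * (H N z).im := by
  rw [H_neg_conj, ← sub_eq_add_neg, Complex.sub_conj]
  push_cast; ring

/-- The Gaussian rationals as a subfield of the complex numbers. -/
def gaussianRat : Subfield ℂ where
  carrier := {z | ∃ a b : ℚ, z = a + b * Complex.I}
  mul_mem' := by
    rintro _ _ ⟨a, b, rfl⟩ ⟨c, d, rfl⟩
    refine ⟨a * c - b * d, a * d + b * c, ?_⟩
    push_cast
    linear_combination (b * d : ℂ) * Complex.I_sq
  one_mem' := ⟨1, 0, by simp⟩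
  add_mem' := by
    rintro _ _ ⟨a, b, rfl⟩ ⟨c, d, rfl⟩
    exact ⟨a + c, b + d, by push_cast; ring⟩
  zero_mem' := ⟨0, 0, by simp⟩
  neg_mem' := by
    rintro _ ⟨a, b, rfl⟩
    exact ⟨-a, -b, by push_cast; ring⟩
  inv_mem' := by
    rintro _ ⟨a, b, rfl⟩
    refine ⟨a / (a ^ 2 + b ^ 2), -b / (a ^ 2 + b ^ 2), ?_⟩
    rw [Complex.inv_def]
    have h : Complex.normSq ((a : ℂ) + b * Complex.I) = ((a ^ 2 + b ^ 2 : ℚ) : ℝ) := by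
      rw [Complex.normSq_apply]; simp; ring
    rw [h]
    simp only [map_add, map_mul, map_ratCast, Complex.conj_I]
    push_cast
    ring

theorem I_mem_gaussianRat : Complex.I ∈ gaussianRat := ⟨0, 1, by simp⟩

theorem exists_rat_im_of_mem_gaussianRat {z : ℂ} (hz : z ∈ gaussianRat) :
    ∃ r : ℚ, (r : ℝ) = z.im := by
  obtain ⟨a, b, rfl⟩ := hz
  exact ⟨b, by simp⟩

open ZetaFamily in
theorem H_mem_gaussianRat (N : ℕ) {z : ℂ} (hz : z ∈ gaussianRat) : H N z ∈ gaussianRat := by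
  refine mul_mem (pow_mem (neg_mem (one_mem _)) _) (sum_mem fun m _ => ?_)
  exact mul_mem (mul_mem (mul_mem (zpow_mem hz _) (natCast_mem _ _)) (SubfieldClass.ratCast_mem _ _))
    (SubfieldClass.ratCast_mem _ _)

/-! ### The linear relation from the Hecke orbits -/

theorem exists_int_two_add_I_pow (m : ℕ) : ∃ a b : ℤ,
    (2 + Complex.I) ^ m = a + b * Complex.I ∧ (2 - Complex.I) ^ m = a - b * Complex.I ∧
      a ^ 2 + b ^ 2 = 5 ^ m := by
  induction m with
  | zero => exact ⟨1, 0, by simp, by simp, by simp⟩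
  | succ m ih =>
    obtain ⟨a, b, h1, h2, h3⟩ := ih
    refine ⟨2 * a - b, a + 2 * b, ?_, ?_, by rw [pow_succ (5 : ℤ), ← h3]; ring⟩
    · rw [pow_succ, h1]; push_cast; linear_combination (b : ℂ) * Complex.I_sq
    · rw [pow_succ, h2]; push_cast; linear_combination (b : ℂ) * Complex.I_sq

theorem abs_le_of_sq_add_sq {a b : ℤ} {n : ℕ} (h : a ^ 2 + b ^ 2 = 5 ^ (4 * n)) :
    |a| ≤ 25 ^ n := by
  refine abs_le_of_sq_le_sq ?_ (by positivity)
  have : ((25 : ℤ) ^ n) ^ 2 = 5 ^ (4 * n) := by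
    rw [← pow_mul, pow_mul 5, mul_comm n 2, pow_mul]; norm_num
  rw [this, ← h]
  nlinarith [sq_nonneg b]

open ZetaFamily in
/-- The linear relation between the completed Lambert series at `2i`, `5i/2`, `5i` and `10i`. -/
theorem lambertE_relation {n : ℕ} (hn : 1 ≤ n) {a b : ℤ}
    (h1 : (2 + Complex.I) ^ (4 * n) = a + b * Complex.I)
    (h2 : (2 - Complex.I) ^ (4 * n) = a - b * Complex.I) :
    (1 - (2 * (16 : ℂ) ^ n + 1) / (-4) ^ n) * (lambertE (4 * n + 1) (10 * Complex.I)
        + 16 ^ n * lambertE (4 * n + 1) (5 * Complex.I / 2)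
        - (2 * 16 ^ n + (-4) ^ n + 1) * lambertE (4 * n + 1) (5 * Complex.I))
      + (2 * a - 5 * 625 ^ n - 1) * lambertE (4 * n + 1) (2 * Complex.I)
      + 625 ^ n * (2 ^ (4 * n + 1) * (Real.pi : ℂ) ^ (4 * n + 1) / (Nat.factorial (4 * n + 2)))
        * ((2 * H (2 * n) ((2 + 2 * Complex.I) / 5)
            + 2 * H (2 * n) ((1 + 2 * Complex.I) / 5)
            + H (2 * n) (2 * Complex.I / 5)).im : ℝ) = 0 := by
  have hI := Complex.I_sq
  have hI4 : Complex.I ^ (4 * n) = 1 := by rw [pow_mul, Complex.I_pow_four, one_pow]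
  have h5 : (5 : ℂ) ^ (4 * n) = 625 ^ n := by rw [pow_mul]; norm_num
  have hR : ∀ τ : ℂ, 0 < τ.im → lambertE (4 * n + 1) τ = τ ^ (4 * n) * lambertE (4 * n + 1) (-1 / τ)
      + -Complex.I * (2 ^ (4 * n + 1) * (Real.pi : ℂ) ^ (4 * n + 1)
          / (Nat.factorial (4 * n + 2))) * H (2 * n) τ := by
    intro τ hτ
    have := lambertE_sub_eq (p := 2 * n) (by omega) hτ
    rw [show 2 * (2 * n) = 4 * n by ring] at this
    linear_combination this
  have hinv : ∀ {z w : ℂ}, z * w = -1 → -1 / z = w := fun {z w} h => by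
    have : z ≠ 0 := by rintro rfl; simp at h
    rw [div_eq_iff this, ← h, mul_comm]
  have T5 := sum_lambertE_hecke (p := 5) (k := 4 * n + 1) (by norm_num) (τ := 2 * Complex.I) (by simp)
  have T2 := sum_lambertE_hecke (p := 2) (k := 4 * n + 1) (by norm_num) (τ := 5 * Complex.I) (by simp)
  have T2' := sum_lambertE_hecke (p := 2) (k := 4 * n + 1) (by norm_num)
    (τ := (5 * Complex.I + 1) / 2) (by simp)
  simp only [Finset.sum_range_succ, Finset.sum_range_zero, zero_add] at T5 T2 T2'
  push_cast at T5 T2 T2'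
  rw [add_zero] at T5 T2 T2'
  have p5 : (5 : ℂ) / 5 ^ (4 * n + 1) = 1 / 625 ^ n := by
    rw [pow_succ, h5]; field_simp
  have p2 : (2 : ℂ) / 2 ^ (4 * n + 1) = 1 / 16 ^ n := by
    rw [pow_succ, pow_mul]; norm_num; field_simp
  rw [p5] at T5
  rw [p2] at T2 T2'
  -- the five points of the Hecke orbit of `2i`
  have A0 := hR (2 * Complex.I / 5) (by simp)
  have A1 := hR ((1 + 2 * Complex.I) / 5) (by simp)
  have A1' := hR ((-1 + 2 * Complex.I) / 5) (by simp)
  have A2 := hR ((2 + 2 * Complex.I) / 5) (by simp)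
  have A2' := hR ((-2 + 2 * Complex.I) / 5) (by simp)
  -- Images under inversion, split as a representative plus an integer that the period of `lambertE`
  -- absorbs. For (±2+2i)/5 they are (∓5+5i)/4, translates of the T_2-orbit of (5i+1)/2.
  rw [hinv (w := 5 * Complex.I / 2) (by linear_combination hI)] at A0
  rw [hinv (w := 2 * Complex.I + (-1 : ℤ)) (by push_cast; linear_combination (4 / 5) * hI),
    lambertE_congr _ rfl] at A1
  rw [hinv (w := 2 * Complex.I + (1 : ℤ)) (by push_cast; linear_combination (4 / 5) * hI),
    lambertE_congr _ rfl] at A1'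
  rw [hinv (w := ((5 * Complex.I + 1) / 2 + 1) / 2 + (-2 : ℤ))
    (by push_cast; linear_combination (1 / 2) * hI), lambertE_congr _ rfl] at A2
  rw [hinv (w := (5 * Complex.I + 1) / 2 / 2 + (1 : ℤ))
    (by push_cast; linear_combination (1 / 2) * hI), lambertE_congr _ rfl] at A2'
  have B1 : lambertE (4 * n + 1) ((2 * Complex.I + 4) / 5)
      = lambertE (4 * n + 1) ((-1 + 2 * Complex.I) / 5) :=
    lambertE_congr 1 (by push_cast; ring)
  have B2 : lambertE (4 * n + 1) ((2 * Complex.I + 3) / 5)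
      = lambertE (4 * n + 1) ((-2 + 2 * Complex.I) / 5) :=
    lambertE_congr 1 (by push_cast; ring)
  have B3 : lambertE (4 * n + 1) (2 * ((5 * Complex.I + 1) / 2))
      = lambertE (4 * n + 1) (5 * Complex.I) :=
    lambertE_congr 1 (by push_cast; ring)
  rw [B1, B2, add_comm (2 * Complex.I) 1, add_comm (2 * Complex.I) 2, A0, A1, A1', A2, A2',
    show 5 * (2 * Complex.I) = 10 * Complex.I by ring] at T5
  rw [show 2 * (5 * Complex.I) = 10 * Complex.I by ring] at T2
  rw [B3] at T2'
  have C0 : (2 * Complex.I / 5) ^ (4 * n) = 16 ^ n / 625 ^ n := by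
    rw [div_pow, h5, mul_pow, hI4, pow_mul]; norm_num
  have C1 : ((1 + 2 * Complex.I) / 5) ^ (4 * n) = (a - b * Complex.I) / 625 ^ n := by
    rw [div_pow, h5, ← h2, show 1 + 2 * Complex.I = Complex.I * (2 - Complex.I) by
      linear_combination hI, mul_pow, hI4, one_mul]
  have C1' : ((-1 + 2 * Complex.I) / 5) ^ (4 * n) = (a + b * Complex.I) / 625 ^ n := by
    rw [div_pow, h5, ← h1, show -1 + 2 * Complex.I = Complex.I * (2 + Complex.I) by
      linear_combination -hI, mul_pow, hI4, one_mul]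
  -- All exponentials except 625^n become powers of x = (-4)^n, so that the elimination below is
  -- rational algebra in x and y = 625^n.
  have hx3 : (-64 : ℂ) ^ n = ((-4) ^ n) ^ 3 := by
    rw [← pow_mul, mul_comm, pow_mul]; norm_num
  have hx2 : (16 : ℂ) ^ n = ((-4) ^ n) ^ 2 := by
    rw [← pow_mul, mul_comm, pow_mul]; norm_num
  have C2 : ((2 + 2 * Complex.I) / 5) ^ (4 * n) = ((-4) ^ n) ^ 3 / 625 ^ n := by
    rw [div_pow, h5, pow_mul, ← hx3]
    congr 2
    linear_combination (16 * Complex.I ^ 2 + 64 * Complex.I + 80) * hI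
  have C2' : ((-2 + 2 * Complex.I) / 5) ^ (4 * n) = ((-4) ^ n) ^ 3 / 625 ^ n := by
    rw [div_pow, h5, pow_mul, ← hx3]
    congr 2
    linear_combination (16 * Complex.I ^ 2 - 64 * Complex.I + 80) * hI
  rw [C0, C1, C1', C2, C2', hx2] at T5
  rw [hx2] at T2 T2' ⊢
  have H0 := H_add_H_neg_conj (2 * n) (2 * Complex.I / 5)
  have H1 := H_add_H_neg_conj (2 * n) ((1 + 2 * Complex.I) / 5)
  have H2 := H_add_H_neg_conj (2 * n) ((2 + 2 * Complex.I) / 5)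
  simp only [map_div₀, map_add, map_mul, map_ofNat, map_one, Complex.conj_I] at H0 H1 H2
  rw [show -(2 * -Complex.I / 5) = 2 * Complex.I / 5 by ring] at H0
  rw [show -((1 + 2 * -Complex.I) / 5) = (-1 + 2 * Complex.I) / 5 by ring] at H1
  rw [show -((2 + 2 * -Complex.I) / 5) = (-2 + 2 * Complex.I) / 5 by ring] at H2
  have hIm : (2 * H (2 * n) ((2 + 2 * Complex.I) / 5)
            + 2 * H (2 * n) ((1 + 2 * Complex.I) / 5)
            + H (2 * n) (2 * Complex.I / 5)).im
        = 2 * (H (2 * n) ((2 + 2 * Complex.I) / 5)).im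
          + 2 * (H (2 * n) ((1 + 2 * Complex.I) / 5)).im + (H (2 * n) (2 * Complex.I / 5)).im := by
    simp
  rw [hIm]
  push_cast
  have hx0 : ((-4 : ℂ)) ^ n ≠ 0 := pow_ne_zero _ (by norm_num)
  have h50 : ((625 : ℂ)) ^ n ≠ 0 := pow_ne_zero _ (by norm_num)
  generalize (2 : ℂ) ^ (4 * n + 1) * (Real.pi : ℂ) ^ (4 * n + 1) / (Nat.factorial (4 * n + 2)) = c at *
  generalize ((-4 : ℂ)) ^ n = x at *
  generalize ((625 : ℂ)) ^ n = y at *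
  generalize lambertE (4 * n + 1) (10 * Complex.I) = E20 at *
  generalize lambertE (4 * n + 1) (5 * Complex.I) = E10 at *
  generalize lambertE (4 * n + 1) (5 * Complex.I / 2) = E5 at *
  generalize lambertE (4 * n + 1) (2 * Complex.I) = E4 at *
  generalize lambertE (4 * n + 1) ((5 * Complex.I + 1) / 2) = X at *
  generalize lambertE (4 * n + 1) ((5 * Complex.I + 1) / 2 / 2) = Y at *
  generalize lambertE (4 * n + 1) (((5 * Complex.I + 1) / 2 + 1) / 2) = Z at *
  -- The T_2-orbit of 5i is {5i/2, (5i+1)/2}, so its relation determines X; the relation at (5i+1)/2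
  -- then determines Y + Z.
  have eX : X = (2 + 1 / x ^ 2) * E10 - 1 / x ^ 2 * E20 - E5 := by linear_combination T2
  have eY : Y + Z = (2 + 1 / x ^ 2) * X - 1 / x ^ 2 * E10 := T2'
  have eT : x ^ 2 * E5 + 2 * a * E4 + x ^ 3 * (Y + Z)
      + y * c * (2 * (H (2 * n) ((2 + 2 * Complex.I) / 5)).im
          + 2 * (H (2 * n) ((1 + 2 * Complex.I) / 5)).im + (H (2 * n) (2 * Complex.I / 5)).im)
      = (5 * y + 1) * E4 - E20 := by
    have e0 : -Complex.I * c * H (2 * n) (2 * Complex.I / 5)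
        = c * (H (2 * n) (2 * Complex.I / 5)).im := by
      linear_combination (-Complex.I * c / 2) * H0 -
        c * ((H (2 * n) (2 * Complex.I / 5)).im) * hI
    have e1 : -Complex.I * c * (H (2 * n) ((1 + 2 * Complex.I) / 5)
        + H (2 * n) ((-1 + 2 * Complex.I) / 5))
        = 2 * c * (H (2 * n) ((1 + 2 * Complex.I) / 5)).im := by
      linear_combination (-Complex.I * c) * H1 -
        2 * c * ((H (2 * n) ((1 + 2 * Complex.I) / 5)).im) * hI
    have e2 : -Complex.I * c * (H (2 * n) ((2 + 2 * Complex.I) / 5)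
        + H (2 * n) ((-2 + 2 * Complex.I) / 5))
        = 2 * c * (H (2 * n) ((2 + 2 * Complex.I) / 5)).im := by
      linear_combination (-Complex.I * c) * H2 -
        2 * c * ((H (2 * n) ((2 + 2 * Complex.I) / 5)).im) * hI
    have i1 : y * y⁻¹ = 1 := mul_inv_cancel₀ h50
    linear_combination y * T5 - (x ^ 2 * E5 + 2 * a * E4 + x ^ 3 * (Y + Z) - E4 + E20) * i1
      - y * e0 - y * e1 - y * e2
  have e : x ^ 3 * ((2 + 1 / x ^ 2) * ((2 + 1 / x ^ 2) * E10 - 1 / x ^ 2 * E20 - E5)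
      - 1 / x ^ 2 * E10) = (1 - (2 * x ^ 2 + 1) / x) * (E20 + x ^ 2 * E5
        - (2 * x ^ 2 + x + 1) * E10) - x ^ 2 * E5 - E20 := by
    field_simp
    ring
  rw [eY, eX, e] at eT
  linear_combination eT

/-! ### Convergence and merit of the real series -/

namespace ZetaFamily

theorem summable_lambertTerm (k : ℕ) {q : ℝ} (h0 : 0 < q) (h1 : q < 1) :
    Summable (lambertTerm k q) := by
  have h := summable_lambertC k (q := (q : ℂ)) (by rw [Complex.norm_real, Real.norm_of_nonneg h0.le]; exact h1)
  rw [← Complex.summable_ofReal]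
  refine (h.comp_injective Nat.succPNat_injective).congr fun m => ?_
  simp [lambertTerm]

theorem lambertC_ofReal (k : ℕ) (q : ℝ) : lambertC k (q : ℂ) = (lambertS k q : ℂ) := by
  rw [lambertC, tsum_pnat_eq_tsum_succ
    (f := fun j : ℕ => 1 / (j : ℂ) ^ k * ((q : ℂ) ^ j / (1 - (q : ℂ) ^ j))), lambertS,
    Complex.ofReal_tsum]
  refine tsum_congr fun m => ?_
  simp [lambertTerm]

/-- If t_m is asymptotic to c r^{m+1}/(m+1)^k with c ≠ 0, the polynomial factor disappears in the
ratio of successive terms. -/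
theorem hasMerit_of_tendsto {t : ℕ → ℝ} {a c : ℝ} (k : ℕ) (hc : c ≠ 0)
    (h : Filter.Tendsto (fun m : ℕ => t m * ((m : ℝ) + 1) ^ k /
      Real.exp (-Real.pi * Real.sqrt a) ^ (m + 1)) Filter.atTop (nhds c)) : HasMerit t a := by
  unfold HasMerit
  set r := Real.exp (-Real.pi * Real.sqrt a)
  have hr : 0 < r := Real.exp_pos _
  have h1 := ((Filter.tendsto_add_atTop_iff_nat 1).mpr h).div h hc
  have h2 : Filter.Tendsto (fun m : ℕ => ((m : ℝ) + 1) / ((m : ℝ) + 1 + 1)) Filter.atTop (nhds 1) := by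
    have := (Filter.tendsto_add_atTop_iff_nat 1).mpr (tendsto_natCast_div_add_atTop (1 : ℝ))
    simpa using this
  have h3 := (h1.mul (h2.pow k)).mul_const r
  rw [div_self hc, one_pow, one_mul, one_mul] at h3
  refine h3.congr fun m => ?_
  have e1 : (m : ℝ) + 1 ≠ 0 := by positivity
  have e2 : (m : ℝ) + 1 + 1 ≠ 0 := by positivity
  simp only [Pi.div_apply]
  push_cast
  -- A vanishing term is harmless: division by zero makes both sides 0.
  by_cases ht : t m = 0
  · simp [ht]
  · rw [div_pow]
    field_simp
    ring

theorem lambertTerm_mul_div {k : ℕ} {q r : ℝ} (m : ℕ) :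
    lambertTerm k q m * ((m : ℝ) + 1) ^ k / r ^ (m + 1)
      = (q / r) ^ (m + 1) * (1 - q ^ (m + 1))⁻¹ := by
  have e1 : (m : ℝ) + 1 ≠ 0 := by positivity
  rw [lambertTerm, div_pow]
  field_simp

theorem tendsto_inv_one_sub_pow {q : ℝ} (h0 : 0 < q) (h1 : q < 1) :
    Filter.Tendsto (fun m : ℕ => (1 - q ^ (m + 1))⁻¹) Filter.atTop (nhds 1) := by
  have h := (Filter.tendsto_add_atTop_iff_nat 1).mpr (tendsto_pow_atTop_nhds_zero_of_lt_one h0.le h1)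
  have := (h.const_sub 1).inv₀ (by norm_num)
  simpa using this

theorem tendsto_lambertTerm_self (k : ℕ) {q : ℝ} (h0 : 0 < q) (h1 : q < 1) :
    Filter.Tendsto (fun m : ℕ => lambertTerm k q m * ((m : ℝ) + 1) ^ k / q ^ (m + 1))
      Filter.atTop (nhds 1) := by
  refine (tendsto_inv_one_sub_pow h0 h1).congr fun m => ?_
  rw [lambertTerm_mul_div, div_self h0.ne', one_pow, one_mul]

theorem tendsto_lambertTerm_of_lt (k : ℕ) {q r : ℝ} (h0 : 0 < q) (h1 : q < 1) (h2 : q < r) :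
    Filter.Tendsto (fun m : ℕ => lambertTerm k q m * ((m : ℝ) + 1) ^ k / r ^ (m + 1))
      Filter.atTop (nhds 0) := by
  have hr : 0 < r := h0.trans h2
  have h := (Filter.tendsto_add_atTop_iff_nat 1).mpr
    (tendsto_pow_atTop_nhds_zero_of_lt_one (div_pos h0 hr).le ((div_lt_one hr).mpr h2))
  have := h.mul (tendsto_inv_one_sub_pow h0 h1)
  rw [zero_mul] at this
  exact this.congr fun m => (lambertTerm_mul_div m).symm

theorem q₁_pos : 0 < q₁ := Real.exp_pos _

theorem q₁_lt_one : q₁ < 1 := by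
  rw [q₁, Real.exp_lt_one_iff]; linarith [Real.pi_pos]

theorem exp_neg_pi_mul_sqrt_sq (j : ℕ) :
    Real.exp (-Real.pi * Real.sqrt ((j : ℝ) ^ 2)) = q₁ ^ j := by
  rw [Real.sqrt_sq (Nat.cast_nonneg j), q₁, ← Real.exp_nat_mul]
  congr 1; ring

theorem q₁_pow_pos (j : ℕ) : 0 < q₁ ^ j := pow_pos q₁_pos j

theorem q₁_pow_lt_one {j : ℕ} (hj : j ≠ 0) : q₁ ^ j < 1 := pow_lt_one₀ q₁_pos.le q₁_lt_one hj

theorem hasMerit_lambertTerm (k : ℕ) {j : ℕ} (hj : j ≠ 0) :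
    HasMerit (lambertTerm k (q₁ ^ j)) ((j : ℝ) ^ 2) := by
  refine hasMerit_of_tendsto k one_ne_zero ?_
  rw [exp_neg_pi_mul_sqrt_sq]
  exact tendsto_lambertTerm_self k (q₁_pow_pos j) (q₁_pow_lt_one hj)

/-- A linear combination of Lambert series inherits the merit of its dominant member. -/
theorem hasMerit_sum_lambertTerm (k : ℕ) {s : Finset ℕ} {j₀ : ℕ} (hj₀ : j₀ ≠ 0) (hs : j₀ ∈ s)
    (hmin : ∀ j ∈ s, j₀ ≤ j) {D : ℕ → ℝ} (hD : D j₀ ≠ 0) :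
    HasMerit (fun m => ∑ j ∈ s, D j * lambertTerm k (q₁ ^ j) m) ((j₀ : ℝ) ^ 2) := by
  refine hasMerit_of_tendsto k hD ?_
  rw [exp_neg_pi_mul_sqrt_sq]
  have h : ∀ j ∈ s, Filter.Tendsto (fun m : ℕ => D j * (lambertTerm k (q₁ ^ j) m *
      ((m : ℝ) + 1) ^ k / (q₁ ^ j₀) ^ (m + 1))) Filter.atTop (nhds (if j₀ = j then D j else 0)) := by
    intro j hj
    split_ifs with h
    · subst h
      simpa using (tendsto_lambertTerm_self k (q₁_pow_pos j₀) (q₁_pow_lt_one hj₀)).const_mul (D j₀)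
    · have hlt : j₀ < j := lt_of_le_of_ne (hmin j hj) h
      simpa using (tendsto_lambertTerm_of_lt k (q₁_pow_pos j) (q₁_pow_lt_one (by omega))
        (pow_lt_pow_right_of_lt_one₀ q₁_pos q₁_lt_one hlt)).const_mul (D j)
  have h2 := tendsto_finsetSum s h
  rw [Finset.sum_ite_eq, if_pos hs] at h2
  refine h2.congr fun m => ?_
  rw [Finset.sum_mul, Finset.sum_div]
  exact Finset.sum_congr rfl fun j _ => by ring

theorem lambertE_eq (k j : ℕ) {τ : ℂ} (h : 2 * τ = j * Complex.I) :
    lambertE k τ = riemannZeta k + 2 * (lambertS k (q₁ ^ j) : ℂ) := by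
  rw [lambertE, ← lambertC_ofReal]
  congr 3
  rw [q₁, ← Real.exp_nat_mul, Complex.ofReal_exp]
  congr 1
  push_cast
  linear_combination (Real.pi * Complex.I) * h + (Real.pi * j) * Complex.I_sq

end ZetaFamily

/-! ### Assembly of the evaluation of ζ(4n+1) -/

theorem mainTheorem4 (n : ℕ) (hn : 1 ≤ n) :
    ∃ (d : ℤ) (D : ℕ → ℚ),
      -- the closed form of `d_n`, which is a nonzero integer
      (d : ℂ) = 5 ^ (4 * n + 1) - 2 * (-4) ^ (3 * n) - 2 ^ (4 * n)
          - (2 + Complex.I) ^ (4 * n) - (2 - Complex.I) ^ (4 * n) ∧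
      d ≠ 0 ∧
      -- the coefficients of the Lambert series
      D 20 = D 5 / 2 ^ (4 * n) ∧
      D 20 = (1 - (2 ^ (4 * n + 1) + 1) / (-4) ^ n) * (2 / (d : ℚ)) ∧
      D 20 ≠ 0 ∧
      D 10 / D 20 = -(2 ^ (4 * n + 1) + (-4) ^ n + 1) ∧
      ∑ j ∈ ({4, 5, 10, 20} : Finset ℕ), D j = -2 ∧
      -- the coefficient of `π ^ k`
      (((Nat.factorial (4 * n) : ℚ) * (2 * n + 1) * (4 * n + 3) / 2 ^ (4 * n) * d * D 0 : ℚ) : ℝ)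
        = (4 * (n : ℝ) + 3) * 5 ^ (4 * n) / (4 * n + 1) *
          (2 * ZetaFamily.H (2 * n) ((2 + 2 * Complex.I) / 5)
            + 2 * ZetaFamily.H (2 * n) ((1 + 2 * Complex.I) / 5)
            + ZetaFamily.H (2 * n) (2 * Complex.I / 5)).im ∧
      -- the evaluation of `ζ(4n+1)`, in terms of convergent Lambert series
      (∀ j ∈ ({4, 5, 10, 20} : Finset ℕ),
        Summable (ZetaFamily.lambertTerm (4 * n + 1) (ZetaFamily.q₁ ^ j))) ∧
      riemannZeta ((4 * n + 1 : ℕ) : ℂ) =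
        (((D 0 : ℝ) * Real.pi ^ (4 * n + 1)
          + ∑ j ∈ ({4, 5, 10, 20} : Finset ℕ),
              (D j : ℝ) * ZetaFamily.lambertS (4 * n + 1) (ZetaFamily.q₁ ^ j) : ℝ) : ℂ) ∧
      -- merit 16: of the combined series, and as the least merit among the four Lambert series
      ZetaFamily.HasMerit
        (fun m => ∑ j ∈ ({4, 5, 10, 20} : Finset ℕ),
          (D j : ℝ) * ZetaFamily.lambertTerm (4 * n + 1) (ZetaFamily.q₁ ^ j) m) 16 ∧
      D 4 ≠ 0 ∧
      (∀ j ∈ ({4, 5, 10, 20} : Finset ℕ),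
        ZetaFamily.HasMerit
          (ZetaFamily.lambertTerm (4 * n + 1) (ZetaFamily.q₁ ^ j)) ((j : ℝ) ^ 2)) := by
  obtain ⟨a, b, h1, h2, h3⟩ := exists_int_two_add_I_pow (4 * n)
  have ha := abs_le.mp (abs_le_of_sq_add_sq h3)
  obtain ⟨R, hR⟩ := exists_rat_im_of_mem_gaussianRat
    (z := 2 * ZetaFamily.H (2 * n) ((2 + 2 * Complex.I) / 5)
            + 2 * ZetaFamily.H (2 * n) ((1 + 2 * Complex.I) / 5)
            + ZetaFamily.H (2 * n) (2 * Complex.I / 5)) (by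
      have hI := I_mem_gaussianRat
      have hN : ∀ m : ℕ, [m.AtLeastTwo] → (OfNat.ofNat m : ℂ) ∈ gaussianRat :=
        fun m => ofNat_mem _ m
      have m1 := hN 2
      have m2 := hN 5
      have m3 := one_mem gaussianRat
      have k1 := H_mem_gaussianRat (2 * n) (div_mem (add_mem m1 (mul_mem m1 hI)) m2)
      have k2 := H_mem_gaussianRat (2 * n) (div_mem (add_mem m3 (mul_mem m1 hI)) m2)
      have k3 := H_mem_gaussianRat (2 * n) (div_mem (mul_mem m1 hI) m2)
      exact add_mem (add_mem (mul_mem m1 k1) (mul_mem m1 k2)) k3)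
  have hrel := lambertE_relation hn h1 h2
  rw [← hR, ZetaFamily.lambertE_eq _ 20 (by push_cast; ring), ZetaFamily.lambertE_eq _ 5 (by push_cast; ring),
    ZetaFamily.lambertE_eq _ 10 (by push_cast; ring),
    ZetaFamily.lambertE_eq _ 4 (by push_cast; ring)] at hrel
  obtain ⟨x, hx⟩ : ∃ x : ℤ, x = (-4) ^ n := ⟨_, rfl⟩
  have hx3 : (-4 : ℤ) ^ (3 * n) = x ^ 3 := by rw [hx, ← pow_mul, mul_comm]
  have hx2 : (2 : ℤ) ^ (4 * n) = x ^ 2 := by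
    rw [hx, ← pow_mul, mul_comm n, pow_mul, pow_mul]; norm_num
  have h5 : (5 : ℤ) ^ (4 * n) = 625 ^ n := by rw [pow_mul]; norm_num
  have h16 : (16 : ℤ) ^ n = x ^ 2 := by rw [← hx2, pow_mul]; norm_num
  have hx3abs : |x ^ 3| = 64 ^ n := by
    rw [← hx3, pow_mul, abs_pow]; norm_num
  have hx3le := abs_le.mp hx3abs.le
  have hx0 : x ≠ 0 := by rw [hx]; exact pow_ne_zero _ (by norm_num)
  have g1 : (1 : ℤ) ≤ 625 ^ n := one_le_pow₀ (by norm_num)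
  have g25 : (25 : ℤ) ^ n * 5 ≤ 625 ^ n := by
    calc (25 : ℤ) ^ n * 5 ≤ 25 ^ n * 25 ^ n := by
          gcongr
          calc (5 : ℤ) ≤ 25 ^ 1 := by norm_num
            _ ≤ 25 ^ n := pow_le_pow_right₀ (by norm_num) hn
      _ = 625 ^ n := by rw [← mul_pow]; norm_num
  have g64 : (64 : ℤ) ^ n ≤ 625 ^ n := pow_le_pow_left₀ (by norm_num) (by norm_num) n
  have g16 : (16 : ℤ) ^ n ≤ 25 ^ n := pow_le_pow_left₀ (by norm_num) (by norm_num) n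
  have g4 : x < 2 * x ^ 2 + 1 := by nlinarith [sq_nonneg (x - 1)]
  obtain ⟨d, hd⟩ : ∃ d : ℤ, d = 5 * 625 ^ n - 2 * x ^ 3 - x ^ 2 - 2 * a := ⟨_, rfl⟩
  -- Here |x³| = 64^n ≤ 625^n, while x² = 16^n and |a| are at most 25^n ≤ 625^n/5.
  have hd0 : 0 < d := by rw [hd, ← h16]; linarith
  have hE4 : 0 < 5 * 625 ^ n + 1 - 2 * a := by linarith
  have hdQ : (d : ℚ) ≠ 0 := by exact_mod_cast hd0.ne'
  have hxQ : (x : ℚ) ≠ 0 := by exact_mod_cast hx0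
  have hdQe : (d : ℚ) = 5 * 625 ^ n - 2 * x ^ 3 - x ^ 2 - 2 * a := by exact_mod_cast hd
  have q4 : (-4 : ℚ) ^ n = x := by exact_mod_cast hx.symm
  have q2 : (2 : ℚ) ^ (4 * n) = (x : ℚ) ^ 2 := by exact_mod_cast hx2
  have r5 : (5 : ℝ) ^ (4 * n) = 625 ^ n := by exact_mod_cast h5
  have c3 : (-4 : ℂ) ^ (3 * n) = (x : ℂ) ^ 3 := by exact_mod_cast hx3
  have c2 : (2 : ℂ) ^ (4 * n) = (x : ℂ) ^ 2 := by exact_mod_cast hx2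
  have c4 : (-4 : ℂ) ^ n = x := by exact_mod_cast hx.symm
  have c16 : (16 : ℂ) ^ n = (x : ℂ) ^ 2 := by exact_mod_cast h16
  have c5 : (5 : ℂ) ^ (4 * n) = 625 ^ n := by exact_mod_cast h5
  have hxC : (x : ℂ) ≠ 0 := by exact_mod_cast hx0
  have hdC : (d : ℂ) ≠ 0 := by exact_mod_cast hd0.ne'
  have hdCe : (d : ℂ) = 5 * 625 ^ n - 2 * x ^ 3 - x ^ 2 - 2 * a := by exact_mod_cast hd
  -- Each D_j is 2/d times the coefficient of the corresponding E in the linear relation, the 2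
  -- coming from E = ζ + 2S. `D20` is nonzero because x < 2x² + 1.
  obtain ⟨D20, hD20⟩ : ∃ D20 : ℚ, D20 = (1 - (2 * (x : ℚ) ^ 2 + 1) / x) * (2 / d) := ⟨_, rfl⟩
  have hD20ne : D20 ≠ 0 := by
    rw [hD20]
    refine mul_ne_zero ?_ (div_ne_zero two_ne_zero hdQ)
    rw [sub_ne_zero, ne_eq, eq_div_iff hxQ, one_mul]
    exact_mod_cast g4.ne
  obtain ⟨D4, hD4⟩ : ∃ D4 : ℚ, D4 = -(5 * 625 ^ n + 1 - 2 * (a : ℚ)) * (2 / d) := ⟨_, rfl⟩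
  have hD4ne : D4 ≠ 0 := by
    rw [hD4]
    refine mul_ne_zero (neg_ne_zero.mpr ?_) (div_ne_zero two_ne_zero hdQ)
    exact_mod_cast hE4.ne'
  obtain ⟨D0, hD0⟩ : ∃ D0 : ℚ, D0 = 625 ^ n * (2 * (x : ℚ) ^ 2) * R
      / (Nat.factorial (4 * n + 2) * d) := ⟨_, rfl⟩
  let D : ℕ → ℚ := fun j => if j = 0 then D0 else if j = 4 then D4 else if j = 5 then x ^ 2 * D20
    else if j = 10 then -(2 * x ^ 2 + x + 1) * D20 else D20
  have v0 : D 0 = D0 := rfl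
  have v4 : D 4 = D4 := rfl
  have v5 : D 5 = x ^ 2 * D20 := rfl
  have v10 : D 10 = -(2 * x ^ 2 + x + 1) * D20 := rfl
  have v20 : D 20 = D20 := rfl
  have hsum : ∀ {A : Type} [AddCommMonoid A] (f : ℕ → A),
      ∑ j ∈ ({4, 5, 10, 20} : Finset ℕ), f j = f 4 + (f 5 + (f 10 + f 20)) := by
    intro A _ f
    rw [Finset.sum_insert (by simp), Finset.sum_insert (by simp), Finset.sum_insert (by simp),
      Finset.sum_singleton]
  have hf : (Nat.factorial (4 * n + 2) : ℚ) = (4 * n + 2) * (4 * n + 1) * Nat.factorial (4 * n) := by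
    rw [Nat.factorial_succ, Nat.factorial_succ]; push_cast; ring
  have hf0 : (Nat.factorial (4 * n) : ℚ) ≠ 0 := by exact_mod_cast Nat.factorial_ne_zero _
  refine ⟨d, D, ?_, hd0.ne', ?_, ?_, ?_, ?_, ?_, ?_, ?_, ?_, ?_, ?_, ?_⟩
  · rw [h1, h2, c3, c2, pow_succ (5 : ℂ), c5, hdCe]; ring
  · rw [v20, v5, q2]; field_simp
  · rw [v20, hD20, pow_succ (2 : ℚ), q2, q4]; ring
  · rwa [v20]
  · rw [v10, v20, pow_succ (2 : ℚ), q2, q4]; field_simp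
  · rw [hsum, v4, v5, v10, v20, hD4, hD20]
    field_simp
    rw [hdQe]
    ring
  · rw [v0, ← hR, r5]
    have : (Nat.factorial (4 * n) : ℚ) * (2 * n + 1) * (4 * n + 3) / 2 ^ (4 * n) * d * D0
        = (4 * n + 3) * 625 ^ n / (4 * n + 1) * R := by
      have e1 : (4 * n + 1 : ℚ) ≠ 0 := by positivity
      have e2 : (4 * n + 2 : ℚ) ≠ 0 := by positivity
      rw [hD0, hf, q2]
      field_simp
      ring
    rw [this]
    push_cast
    ring
  · intro j hj
    refine ZetaFamily.summable_lambertTerm _ (ZetaFamily.q₁_pow_pos j) (ZetaFamily.q₁_pow_lt_one ?_)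
    rintro rfl
    simp at hj
  · rw [hsum, v0, v4, v5, v10, v20]
    rw [c16, c4, pow_succ (2 : ℂ), c2] at hrel
    have hfC : (Nat.factorial (4 * n + 2) : ℂ) ≠ 0 := by exact_mod_cast Nat.factorial_ne_zero _
    push_cast at hrel ⊢
    generalize riemannZeta (4 * n + 1) = ζ at *
    have e20 : (D20 : ℂ) * d = 2 * (1 - (2 * (x : ℂ) ^ 2 + 1) / x) := by
      rw [hD20]; push_cast; field_simp
    have e4 : (D4 : ℂ) * d = 2 * (2 * a - 5 * 625 ^ n - 1) := by
      rw [hD4]; push_cast; field_simp; ring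
    have e0 : (D0 : ℂ) * d = 625 ^ n * (x ^ 2 * 2 / Nat.factorial (4 * n + 2)) * R := by
      rw [hD0]; push_cast; field_simp
    -- The coefficients of the relation add up to -d, which is therefore the total coefficient of
    -- ζ(k).
    have ez : (1 - (2 * (x : ℂ) ^ 2 + 1) / x) * (1 + x ^ 2 - (2 * x ^ 2 + x + 1))
        + (2 * a - 5 * 625 ^ n - 1) = -d := by
      rw [hdCe]; field_simp; ring
    refine mul_left_cancel₀ hdC ?_
    linear_combination -hrel + ζ * ez - e4 * (ZetaFamily.lambertS (4 * n + 1) (ZetaFamily.q₁ ^ 4) : ℂ)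
      - e0 * (Real.pi : ℂ) ^ (4 * n + 1)
      - e20 * ((ZetaFamily.lambertS (4 * n + 1) (ZetaFamily.q₁ ^ 20) : ℂ)
        + x ^ 2 * (ZetaFamily.lambertS (4 * n + 1) (ZetaFamily.q₁ ^ 5) : ℂ)
        - (2 * x ^ 2 + x + 1) * (ZetaFamily.lambertS (4 * n + 1) (ZetaFamily.q₁ ^ 10) : ℂ))
  · have := ZetaFamily.hasMerit_sum_lambertTerm (4 * n + 1) (s := {4, 5, 10, 20}) (j₀ := 4)
      (by norm_num) (by simp) (by simp) (D := fun j => (D j : ℝ)) (by rw [v4]; exact_mod_cast hD4ne)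
    norm_num at this ⊢
    exact this
  · rwa [v4]
  · intro j hj
    refine ZetaFamily.hasMerit_lambertTerm _ ?_
    rintro rfl
    simp at hj
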